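/- Let $N\ge 1$, $d_1,\dots,d_N\ge 0$, and let $(\Omega,\mathcal A,P)$ be a probability space. For $1\le j\le N$ let $h^{(j)}:\mathbb{R}^{d_1}\times\cdots\times\mathbb{R}^{d_N}\to\mathbb{R}^{d_j}$ be Lipschitz continuous, let $x^{(j)}_0$ and $M^{(j)}_{n}$, $n\ge 1$, be $\mathbb{R}^{d_j}$-valued random variables, and let $$x^{(j)}_{n+1}=x^{(j)}_n+\alpha^{(j)}_n\bigl(h^{(j)}(x^{(1)}_n,\dots,x^{(N)}_n)+M^{(j)}_{n+1}\bigr),\qquad n\ge 0,\ 1\le j\le N.$$ Put $\mathcal F_n=\sigma\bigl(x^{(j)}_i,\ 0\le i\le n;\ M^{(j)}_i,\ 1\le i\le n;\ 1\le j\le N\bigr)$. Assume: (Noise) for all $j$ and $n\ge 0$, $M^{(j)}_{n+1}$ is integrable and $\mathbb E[M^{(j)}_{n+1}\mid\mathcal F_n]=0$ a.s., and there are constants $K^{(j)}>0$ with $\mathbb E[\|M^{(j)}_{n+1}\|^2\mid\mathcal F_n]\le K^{(j)}\bigl(1+\sum_{k=1}^N\|x^{(k)}_n\|^2\bigr)$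 a.s. for all $n\ge0$. (Step sizes) the $\alpha^{(j)}_n>0$ are real numbers with $\sum_n\alpha^{(j)}_n=\infty$ for every $j$, $\sum_n\sum_{j}(\alpha^{(j)}_n)^2<\infty$, and $\alpha^{(j)}_n/\alpha^{(j-1)}_n\to 0$ as $n\to\infty$ for $1<j\le N$. (Stability) $\sup_n\sum_{j=1}^N\|x^{(j)}_n\|<\infty$ a.s. (Equilibria) There are Lipschitz continuous maps $\lambda^{(i)}:\mathbb{R}^{d_{i+1}}\times\cdots\times\mathbb{R}^{d_N}\to\mathbb{R}^{d_i}$, $1\le i\le N-1$, and a point $x^{(N)}_*\in\mathbb{R}^{d_N}$ as follows. For $1\le i\le N$ and $(x^{(i)},\dots,x^{(N)})$ define $z^{(j)}=x^{(j)}$ for $j\ge i$ and, recursively for $j=i-1,i-2,\dots,1$, $z^{(j)}=\lambda^{(j)}(z^{(j+1)},\dots,z^{(N)})$; write $H^{(i)}(x^{(i)},\dots,x^{(N)})=h^{(i)}(z^{(1)},\dots,z^{(N)})$. For each $i\le N-1$ and all fixed $x^{(i+1)},\dots,x^{(N)}$, the ODE $\dot u(t)=H^{(i)}(u(t),x^{(i+1)},\dots,x^{(N)})$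 has $\lambda^{(i)}(x^{(i+1)},\dots,x^{(N)})$ as globally asymptotically stable equilibrium, and the ODE $\dot u(t)=H^{(N)}(u(t))$ has $x^{(N)}_*$ as globally asymptotically stable equilibrium. For $v\in\mathbb{R}^{d_N}$ let $\lambda^{(N:N-1)}(v)=v$ and, recursively for $j=N-1,\dots,1$, $\lambda^{(j:N-1)}(v)=\lambda^{(j)}\bigl(\lambda^{(j+1:N-1)}(v),\dots,\lambda^{(N-1:N-1)}(v),v\bigr)$. Then, almost surely, as $n\to\infty$, $x^{(j)}_n\to\lambda^{(j:N-1)}(x^{(N)}_*)$ for every $1\le j\le N-1$, and $x^{(N)}_n\to x^{(N)}_*$. -/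

import Mathlib

open MeasureTheory Filter Topology
open scoped ENNReal

/-- The parameter space of the `j`-th timescale: the Euclidean space of dimension `d j`. -/
abbrev Block {N : ℕ} (d : Fin N → ℕ) (j : Fin N) : Type := EuclideanSpace ℝ (Fin (d j))

/-- The joint parameter space: tuples with one entry per timescale, ordered from the fastest
timescale (smallest index) to the slowest (index `⊤`). -/
abbrev State {N : ℕ} (d : Fin N → ℕ) : Type := ∀ j : Fin N, Block d j

/-- Tuples of parameters of the timescales strictly slower than `i`. -/
abbrev SlowerState {N : ℕ} (d : Fin N → ℕ) (i : Fin N) : Type :=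
  ∀ k : {k : Fin N // i < k}, Block d k.1

/-- `e` is a globally asymptotically stable equilibrium of the autonomous equation `y' = f y`:
it is an equilibrium, it is Lyapunov stable, and every forward solution converges to it. -/
structure IsGlobAsympStable {E : Type*} [NormedAddCommGroup E] [NormedSpace ℝ E]
    (f : E → E) (e : E) : Prop where
  equilibrium : f e = 0
  stable : ∀ ε > 0, ∃ δ > 0, ∀ y : ℝ → E, IsIntegralCurveOn y (fun _ => f) (Set.Ici 0) →
    ‖y 0 - e‖ < δ → ∀ t ≥ 0, ‖y t - e‖ < ε
  attractive : ∀ y : ℝ → E, IsIntegralCurveOn y (fun _ => f) (Set.Ici 0) →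
    Tendsto y atTop (𝓝 e)

/-- Nested substitution of the equilibrium maps below level `i`: the entries with index `j ≥ i` are
those of `x`, and, downwards from `j = i - 1`, every entry with index `j < i` is the value of the
`j`-th equilibrium map at the entries with index larger than `j`. The entries of `x` with index
smaller than `i` are not used. -/
noncomputable def nest {N : ℕ} {d : Fin N → ℕ} (lam : ∀ i : Fin N, SlowerState d i → Block d i)
    (i : Fin N) (x : State d) (j : Fin N) : Block d j :=
  if j < i then lam j (fun k => nest lam i x k.1) else x j
termination_by N - j.val
decreasing_by
  have _hlt : j.val < k.1.val := k.2
  have _hN : k.1.val < N := k.1.isLt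
  omega

theorem nest_of_lt {N : ℕ} {d : Fin N → ℕ} (lam : ∀ i : Fin N, SlowerState d i → Block d i)
    {i j : Fin N} (x : State d) (h : j < i) :
    nest lam i x j = lam j (fun k => nest lam i x k.1) := by
  rw [nest, if_pos h]

theorem nest_of_le {N : ℕ} {d : Fin N → ℕ} (lam : ∀ i : Fin N, SlowerState d i → Block d i)
    {i j : Fin N} (x : State d) (h : i ≤ j) :
    nest lam i x j = x j := by
  rw [nest, if_neg (not_lt.mpr h)]

/-- The right-hand side of the limiting equation of timescale `i`, as a function of `x^{(i)} = u`:
the slower parameters are frozen at their values in `x`, and the faster ones are replaced by the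
nested equilibrium maps. It does not depend on the entries of `x` with index at most `i`. -/
noncomputable def limitField {N : ℕ} {d : Fin N → ℕ} (h : ∀ j : Fin N, State d → Block d j)
    (lam : ∀ i : Fin N, SlowerState d i → Block d i) (i : Fin N) (x : State d)
    (u : Block d i) : Block d i :=
  h i (nest lam i (Function.update x i u))

/-- `lamTo lam j v` is the value at `v` of the composed equilibrium map which expresses the `j`-th
parameter through the slowest one; at the slowest index `j = ⊤` it is `v` itself. -/
noncomputable def lamTo {N : ℕ} [NeZero N] {d : Fin N → ℕ}
    (lam : ∀ i : Fin N, SlowerState d i → Block d i) (j : Fin N) (v : Block d ⊤) : Block d j :=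
  nest lam ⊤ (Function.update 0 ⊤ v) j

/-- The sigma-field generated by the iterates up to time `n` and the noise variables with time
indices `1, …, n`. The arguments are `x j n ω` and `M j n ω`. -/
@[reducible] def history {N : ℕ} {d : Fin N → ℕ} {Ω : Type*} (x M : ∀ j : Fin N, ℕ → Ω → Block d j) (n : ℕ) :
    MeasurableSpace Ω :=
  ⨆ j : Fin N, (⨆ i : ℕ, ⨆ _ : i ≤ n, MeasurableSpace.comap (x j i) inferInstance) ⊔
    (⨆ i : ℕ, ⨆ _ : 1 ≤ i ∧ i ≤ n, MeasurableSpace.comap (M j i) inferInstance)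

/-!
Run time at the speed of timescale `i`. The faster parameters have already reached their
equilibria, the slower ones move with vanishing speed, so up to errors tending to zero the pair
`(x^{(i)}, (x^{(k)})_{k > i})` follows the Euler scheme of the frozen equation
`u' = H^{(i)}(u, w)`, `w' = 0`. Global asymptotic stability for each fixed `w` is uniform for
`(u, w)` in a compact set, so a bounded orbit of the scheme is close to `λ^{(i)}` after a time
window of fixed length; hence `x^{(i)} - λ^{(i)}(x^{(i+1)}, …) → 0`, by induction on `i`.

On the event that the iterates stay bounded, the accumulated noise converges almost surely, being
locally an `L²`-bounded martingale. Adding the remaining future noise to the iterates then leaves a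
scheme whose errors tend to zero.
-/

open Set Metric
open scoped NNReal

section ForwardFlow

variable {E : Type*} [NormedAddCommGroup E] [NormedSpace ℝ E]

theorem isIntegralCurveOn_Ici_of_forall_Icc {y : ℝ → E} {v : ℝ → E → E} {τ : ℝ} (hτ : 0 < τ)
    (h : ∀ n : ℕ, IsIntegralCurveOn y v (Icc (n * τ) ((n + 1) * τ))) :
    IsIntegralCurveOn y v (Ici 0) := by
  intro t ht
  have hright : HasDerivWithinAt y (v t (y t)) (Ici t) t := by
    have hle : ⌊t / τ⌋₊ * τ ≤ t := (le_div_iff₀ hτ).1 (Nat.floor_le (div_nonneg ht hτ.le))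
    have hlt : t < (⌊t / τ⌋₊ + 1) * τ := (div_lt_iff₀ hτ).1 (Nat.lt_floor_add_one _)
    exact ((h _ t ⟨hle, hlt.le⟩).mono (Icc_subset_Icc_left hle)).mono_of_mem_nhdsWithin
      (Icc_mem_nhdsGE hlt)
  rcases (mem_Ici.1 ht).eq_or_lt with rfl | hpos
  · exact hright
  have hleft : HasDerivWithinAt y (v t (y t)) (Iic t) t := by
    obtain ⟨n, hn⟩ := Nat.exists_eq_add_one.2 (Nat.ceil_pos.2 (div_pos hpos hτ))
    have hlt : n * τ < t := (lt_div_iff₀ hτ).1 (Nat.lt_ceil.1 (by lia))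
    have hle : t ≤ (n + 1) * τ := (div_le_iff₀ hτ).1 (by exact_mod_cast hn ▸ Nat.le_ceil (t / τ))
    exact ((h n t ⟨hlt.le, hle⟩).mono (Icc_subset_Icc_right hle)).mono_of_mem_nhdsWithin
      (Icc_mem_nhdsLE hlt)
  exact (hleft.union hright).mono fun s _ => le_total s t

theorem exists_pos_forall_exists_isIntegralCurveOn_Icc [CompleteSpace E] {F : E → E} {K : ℝ≥0}
    (hF : LipschitzWith K F) :
    ∃ τ > 0, ∀ z, ∃ y : ℝ → E, y 0 = z ∧ IsIntegralCurveOn y (fun _ => F) (Icc 0 τ) := by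
  set τ : ℝ := 1 / (2 * (K + 1)) with hτ
  have hτpos : 0 < τ := by positivity
  refine ⟨τ, hτpos, fun z => ?_⟩
  -- On the ball of radius `‖F z‖` around `z` the field is bounded by `(1 + K) * ‖F z‖`.
  have hPL : IsPicardLindelof (fun _ => F) (⟨0, le_rfl, hτpos.le⟩ : Icc (0 : ℝ) τ) z ‖F z‖₊ 0
      ((1 + K) * ‖F z‖₊) K := by
    refine IsPicardLindelof.of_time_independent (fun x hx => ?_) hF.lipschitzOnWith ?_
    · calc ‖F x‖ ≤ ‖F z‖ + ‖F x - F z‖ := norm_le_insert' _ _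
        _ ≤ ‖F z‖ + K * ‖x - z‖ := by gcongr; exact hF.norm_sub_le x z
        _ ≤ ‖F z‖ + K * ‖F z‖ := by gcongr; simpa [dist_eq_norm] using hx
        _ = ((1 + K) * ‖F z‖₊ : ℝ≥0) := by push_cast; ring
    · have hhalf : (1 + K) * ‖F z‖ * τ = ‖F z‖ / 2 := by rw [hτ]; field_simp; ring
      simp only [sub_zero, sub_self, NNReal.coe_mul, NNReal.coe_add, NNReal.coe_one, coe_nnnorm,
        NNReal.coe_zero, max_eq_left hτpos.le, hhalf]
      linarith [norm_nonneg (F z)]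
  exact hPL.exists_eq_forall_mem_Icc_hasDerivWithinAt₀

/-- `Φ` is the semiflow of the vector field `F`: for every `z` the curve `t ↦ Φ z t` is a forward
solution of `y' = F y` started at `z`. The values of `Φ` at negative times are irrelevant. -/
structure IsForwardFlow (F : E → E) (Φ : E → ℝ → E) : Prop where
  init : ∀ z, Φ z 0 = z
  curve : ∀ z, IsIntegralCurveOn (Φ z) (fun _ => F) (Ici 0)

theorem exists_isForwardFlow [CompleteSpace E] {F : E → E} {K : ℝ≥0} (hF : LipschitzWith K F) :
    ∃ Φ, IsForwardFlow F Φ := by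
  obtain ⟨τ, hτ, hloc⟩ := exists_pos_forall_exists_isIntegralCurveOn_Icc hF
  choose φ hφ0 hφ using hloc
  -- Restart the short-time solution at the times `n * τ`.
  set node : E → ℕ → E := fun z n => (fun x => φ x τ)^[n] z
  have hnode : ∀ z n, node z (n + 1) = φ (node z n) τ := fun z n =>
    Function.iterate_succ_apply' _ n z
  set Φ : E → ℝ → E := fun z t => φ (node z ⌊t / τ⌋₊) (t - ⌊t / τ⌋₊ * τ)
  have hΦ : ∀ z (n : ℕ), EqOn (Φ z) (fun t => φ (node z n) (t - n * τ))
      (Icc (n * τ) ((n + 1) * τ)) := by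
    rintro z n t ⟨hnt, htn⟩
    rcases htn.eq_or_lt with rfl | htn
    · have hfloor : ⌊(n + 1 : ℝ) * τ / τ⌋₊ = n + 1 := by
        rw [mul_div_cancel_right₀ _ hτ.ne']; exact_mod_cast Nat.floor_natCast (n + 1)
      simp only [Φ, hfloor, Nat.cast_add_one, sub_self, hφ0, hnode]
      ring_nf
    · have hfloor : ⌊t / τ⌋₊ = n :=
        (Nat.floor_eq_iff (div_nonneg ((by positivity : 0 ≤ n * τ).trans hnt) hτ.le)).2
          ⟨(le_div_iff₀ hτ).2 hnt, (div_lt_iff₀ hτ).2 htn⟩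
      simp only [Φ, hfloor]
  refine ⟨Φ, fun z => by simp [Φ, node, hφ0], fun z =>
    isIntegralCurveOn_Ici_of_forall_Icc hτ fun n t ht => ?_⟩
  have hshift : IsIntegralCurveOn (fun s => φ (node z n) (s - n * τ)) (fun _ => F)
      (Icc (n * τ) ((n + 1) * τ)) :=
    ((hφ (node z n)).comp_sub (n * τ)).mono fun s hs =>
      ⟨s - n * τ, ⟨by linarith [hs.1], by linarith [hs.2]⟩, add_sub_cancel _ _⟩
  rw [hΦ z n ht]
  exact (hshift t ht).congr_of_mem (hΦ z n) ht

namespace IsForwardFlow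

variable {F : E → E} {Φ : E → ℝ → E} {K : ℝ≥0}

theorem continuousOn (hΦ : IsForwardFlow F Φ) (z : E) : ContinuousOn (Φ z) (Ici 0) :=
  (hΦ.curve z).continuousOn

theorem hasDerivWithinAt_Ici (hΦ : IsForwardFlow F Φ) (z : E) {t : ℝ} (ht : 0 ≤ t) :
    HasDerivWithinAt (Φ z) (F (Φ z t)) (Ici t) t :=
  (hΦ.curve z t ht).mono (Ici_subset_Ici.2 ht)

theorem eq_of_isIntegralCurveOn (hΦ : IsForwardFlow F Φ) (hF : LipschitzWith K F) {y : ℝ → E}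
    (hy : IsIntegralCurveOn y (fun _ => F) (Ici 0)) {t : ℝ} (ht : 0 ≤ t) : y t = Φ (y 0) t :=
  ODE_solution_unique (v := fun _ => F) (fun _ => hF)
    (hy.continuousOn.mono Icc_subset_Ici_self)
    (fun s hs => (hy s hs.1).mono (Ici_subset_Ici.2 hs.1))
    ((hΦ.continuousOn _).mono Icc_subset_Ici_self) (fun _ hs => hΦ.hasDerivWithinAt_Ici _ hs.1)
    (hΦ.init _).symm ⟨ht, le_rfl⟩

theorem add (hΦ : IsForwardFlow F Φ) (hF : LipschitzWith K F) (z : E) {s t : ℝ} (hs : 0 ≤ s)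
    (ht : 0 ≤ t) : Φ z (s + t) = Φ (Φ z s) t := by
  have hshift : IsIntegralCurveOn (fun r => Φ z (r + s)) (fun _ => F) (Ici 0) :=
    ((hΦ.curve z).comp_add s).mono fun r hr =>
      ⟨r + s, add_nonneg hr hs, neg_add_cancel_comm_assoc s r⟩
  simpa [add_comm] using hΦ.eq_of_isIntegralCurveOn hF hshift ht

theorem dist_le (hΦ : IsForwardFlow F Φ) (hF : LipschitzWith K F) (z z' : E) {t : ℝ}
    (ht : 0 ≤ t) : dist (Φ z t) (Φ z' t) ≤ dist z z' * Real.exp (K * t) := by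
  simpa using dist_le_of_trajectories_ODE (v := fun _ => F) (fun _ => hF)
    ((hΦ.continuousOn z).mono Icc_subset_Ici_self) (fun _ hs => hΦ.hasDerivWithinAt_Ici z hs.1)
    ((hΦ.continuousOn z').mono Icc_subset_Ici_self) (fun _ hs => hΦ.hasDerivWithinAt_Ici z' hs.1)
    (by rw [hΦ.init, hΦ.init]) t ⟨ht, le_rfl⟩

theorem continuous_apply (hΦ : IsForwardFlow F Φ) (hF : LipschitzWith K F) {t : ℝ}
    (ht : 0 ≤ t) : Continuous fun z => Φ z t :=
  (LipschitzWith.of_dist_le_mul (K := ⟨Real.exp (K * t), (Real.exp_pos _).le⟩) fun z z' => by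
    rw [mul_comm]
    exact hΦ.dist_le hF z z' ht).continuous

end IsForwardFlow

end ForwardFlow

section FrozenField

variable {E W : Type*} [NormedAddCommGroup E] [NormedAddCommGroup W]

/-- The vector field on `E × W` of the system `u' = g u w`, `w' = 0`: it drives the first component
while the second one is a frozen parameter. -/
def frozenField (g : E → W → E) (z : E × W) : E × W := (g z.1 z.2, 0)

theorem lipschitzWith_frozenField {g : E → W → E} {K : ℝ≥0}
    (hg : LipschitzWith K fun z : E × W => g z.1 z.2) : LipschitzWith K (frozenField g) := by
  have := hg.prodMk (LipschitzWith.const (0 : W))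
  rwa [max_eq_left zero_le] at this

end FrozenField

section UniformAttraction

variable {E W : Type*} [NormedAddCommGroup E] [NormedSpace ℝ E]
  [NormedAddCommGroup W] [NormedSpace ℝ W]

namespace IsForwardFlow

variable {F : E → E} {Φ : E → ℝ → E} {K : ℝ≥0}

theorem exists_forall_ge_mem (hΦ : IsForwardFlow F Φ) (hF : LipschitzWith K F) {C : Set E}
    {B : E → Set E} (hC : IsCompact C)
    (h : ∀ z ∈ C, ∃ T ≥ 0, ∀ᶠ z' in 𝓝 z, ∀ t ≥ 0, Φ (Φ z' T) t ∈ B z') :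
    ∃ T, ∀ z ∈ C, ∀ t ≥ T, Φ z t ∈ B z := by
  refine hC.induction_on (p := fun s => ∃ T, ∀ z ∈ s, ∀ t ≥ T, Φ z t ∈ B z) ⟨0, by simp⟩
    (fun s s' hs ⟨T, hT⟩ => ⟨T, fun z hz => hT z (hs hz)⟩) ?_ fun z hz => ?_
  · rintro s s' ⟨T, hT⟩ ⟨T', hT'⟩
    exact ⟨max T T', fun z hz t ht => hz.elim
      (fun hz => hT z hz t ((le_max_left _ _).trans ht))
      (fun hz => hT' z hz t ((le_max_right _ _).trans ht))⟩
  · obtain ⟨T, hT, hev⟩ := h z hz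
    refine ⟨_, mem_nhdsWithin_of_mem_nhds hev, T, fun z' hz' t ht => ?_⟩
    simpa [← hΦ.add hF z' hT (sub_nonneg.2 ht)] using hz' (t - T) (sub_nonneg.2 ht)

theorem exists_dist_lt (hΦ : IsForwardFlow F Φ) {e : E} (he : IsGlobAsympStable F e) (z : E)
    {δ : ℝ} (hδ : 0 < δ) : ∃ T ≥ 0, dist (Φ z T) e < δ :=
  ((eventually_ge_atTop 0).and
    ((he.attractive _ (hΦ.curve z)).eventually (ball_mem_nhds e hδ))).exists

theorem exists_forall_dist_lt_of_dist_lt (hΦ : IsForwardFlow F Φ) {e : E}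
    (he : IsGlobAsympStable F e) {ε : ℝ} (hε : 0 < ε) :
    ∃ δ > 0, ∀ z, dist z e < δ → ∀ t ≥ 0, dist (Φ z t) e < ε := by
  obtain ⟨δ, hδ, hstab⟩ := he.stable ε hε
  refine ⟨δ, hδ, fun z hz t ht => ?_⟩
  rw [dist_eq_norm] at hz ⊢
  exact hstab _ (hΦ.curve z) (by rwa [hΦ.init]) t ht

theorem exists_forall_ge_dist_lt (hΦ : IsForwardFlow F Φ) (hF : LipschitzWith K F) {e : E}
    (he : IsGlobAsympStable F e) {C : Set E} (hC : IsCompact C) {ε : ℝ} (hε : 0 < ε) :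
    ∃ T, ∀ z ∈ C, ∀ t ≥ T, dist (Φ z t) e < ε := by
  obtain ⟨δ, hδ, hstab⟩ := hΦ.exists_forall_dist_lt_of_dist_lt he hε
  refine hΦ.exists_forall_ge_mem hF (B := fun _ => ball e ε) hC fun z _ => ?_
  obtain ⟨T, hT, hz⟩ := hΦ.exists_dist_lt he z hδ
  refine ⟨T, hT, ?_⟩
  filter_upwards [(hΦ.continuous_apply hF hT).continuousAt.eventually (isOpen_ball.mem_nhds hz)]
    with z' hz' using hstab _ hz'

theorem forall_mem_of_return (hΦ : IsForwardFlow F Φ) (hF : LipschitzWith K F) {A B : Set E}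
    {T : ℝ} (hT : 0 < T) (hstay : ∀ z ∈ A, ∀ t ∈ Icc 0 T, Φ z t ∈ B)
    (hreturn : ∀ z ∈ A, Φ z T ∈ A) {z : E} (hz : z ∈ A) {t : ℝ} (ht : 0 ≤ t) : Φ z t ∈ B := by
  have hiter : ∀ k : ℕ, Φ z (k * T) ∈ A := by
    intro k
    induction k with
    | zero => simpa [hΦ.init] using hz
    | succ k ih =>
      rw [Nat.cast_add_one, add_one_mul, hΦ.add hF z (by positivity) hT.le]
      exact hreturn _ ih
  have hle : ⌊t / T⌋₊ * T ≤ t := (le_div_iff₀ hT).1 (Nat.floor_le (by positivity))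
  have hlt : t < (⌊t / T⌋₊ + 1) * T := (div_lt_iff₀ hT).1 (Nat.lt_floor_add_one _)
  rw [← add_sub_cancel (⌊t / T⌋₊ * T) t, hΦ.add hF z (by positivity) (sub_nonneg.2 hle)]
  exact hstay _ (hiter _) _ ⟨sub_nonneg.2 hle, by linarith⟩

end IsForwardFlow

namespace IsForwardFlow

variable {g : E → W → E} {Φ : E × W → ℝ → E × W} {K : ℝ≥0}

theorem snd_eq (hΦ : IsForwardFlow (frozenField g) Φ) (z : E × W) {t : ℝ} (ht : 0 ≤ t) :
    (Φ z t).2 = z.2 := by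
  have hderiv : ∀ s ∈ Icc 0 t, HasDerivWithinAt (fun s => (Φ z s).2) 0 (Icc 0 t) s := fun s hs =>
    ((ContinuousLinearMap.snd ℝ E W).hasFDerivAt.comp_hasDerivWithinAt s
      (hΦ.curve z s hs.1)).mono Icc_subset_Ici_self
  have := (convex_Icc 0 t).norm_image_sub_le_of_norm_hasDerivWithin_le (C := 0) hderiv (by simp)
    (left_mem_Icc.2 ht) (right_mem_Icc.2 ht)
  simpa [hΦ.init, sub_eq_zero] using this

theorem fst_isForwardFlow (hΦ : IsForwardFlow (frozenField g) Φ) (w : W) :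
    IsForwardFlow (fun u => g u w) fun u t => (Φ (u, w) t).1 where
  init u := by rw [hΦ.init]
  curve u t ht := by
    have := (ContinuousLinearMap.fst ℝ E W).hasFDerivAt.comp_hasDerivWithinAt t
      (hΦ.curve (u, w) t ht)
    simpa [frozenField, hΦ.snd_eq (u, w) ht, Function.comp_def] using this

theorem dist_fst_le (hΦ : IsForwardFlow (frozenField g) Φ)
    (hg : LipschitzWith K fun z : E × W => g z.1 z.2) {z : E × W} {w : W} {ρ T t : ℝ}
    (hw : dist z.2 w ≤ ρ * Real.exp (-(K * T))) (ht : t ∈ Icc 0 T) :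
    dist (Φ z t).1 (Φ (z.1, w) t).1 ≤ ρ :=
  calc dist (Φ z t).1 (Φ (z.1, w) t).1 ≤ dist (Φ z t) (Φ (z.1, w) t) := le_max_left _ _
    _ ≤ dist z (z.1, w) * Real.exp (K * t) :=
      hΦ.dist_le (lipschitzWith_frozenField hg) _ _ ht.1
    _ = dist z.2 w * Real.exp (K * t) := by simp [Prod.dist_eq]
    _ ≤ ρ * Real.exp (-(K * T)) * Real.exp (K * T) := by
      have htT : t ≤ T := ht.2
      exact mul_le_mul hw (by gcongr) (by positivity) (dist_nonneg.trans hw)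
    _ = ρ := by rw [mul_assoc, ← Real.exp_add, neg_add_cancel, Real.exp_zero, mul_one]

theorem eventually_forall_dist_lt [ProperSpace E] (hΦ : IsForwardFlow (frozenField g) Φ)
    (hg : LipschitzWith K fun z : E × W => g z.1 z.2) {w : W} {e : E}
    (he : IsGlobAsympStable (fun u => g u w) e) {ε : ℝ} (hε : 0 < ε) :
    ∀ᶠ z in 𝓝 (e, w), ∀ t ≥ 0, dist (Φ z t).1 e < ε := by
  have hflow := hΦ.fst_isForwardFlow w
  have hgw : LipschitzWith K fun u => g u w := by
    simpa [Function.comp_def] using hg.comp (LipschitzWith.prodMk_right w)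
  obtain ⟨δ, hδ, hstab⟩ := hflow.exists_forall_dist_lt_of_dist_lt he (half_pos hε)
  obtain ⟨T₀, hT₀⟩ :=
    hflow.exists_forall_ge_dist_lt hgw he (isCompact_closedBall e δ) (half_pos hδ)
  set T := max T₀ 1
  set ρ := min (δ / 2) (ε / 2)
  have hη : 0 < ρ * Real.exp (-(K * T)) :=
    mul_pos (lt_min (half_pos hδ) (half_pos hε)) (Real.exp_pos _)
  have hT : 0 < T := lt_max_of_lt_right one_pos
  -- Up to time `T` the perturbed flow is `ρ`-close to the flow with parameter `w`; by then the
  -- latter has entered the ball of radius `δ / 2`.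
  set A : Set (E × W) := ball e δ ×ˢ closedBall w (ρ * Real.exp (-(K * T)))
  have hstay : ∀ z ∈ A, ∀ t ∈ Icc 0 T, Φ z t ∈ {z : E × W | dist z.1 e < ε} := by
    rintro z ⟨hz, hw⟩ t ht
    have hclose := (hΦ.dist_fst_le hg hw ht).trans (min_le_right _ _)
    have hfrozen := hstab z.1 hz t ht.1
    change dist (Φ z t).1 e < ε
    linarith [dist_triangle (Φ z t).1 (Φ (z.1, w) t).1 e]
  have hreturn : ∀ z ∈ A, Φ z T ∈ A := by
    rintro z ⟨hz, hw⟩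
    have hclose := (hΦ.dist_fst_le hg hw ⟨hT.le, le_rfl⟩).trans (min_le_left _ _)
    have hfrozen := hT₀ z.1 (ball_subset_closedBall hz) T (le_max_left _ _)
    refine ⟨?_, by rwa [hΦ.snd_eq z hT.le]⟩
    rw [mem_ball]
    linarith [dist_triangle (Φ z T).1 (Φ (z.1, w) T).1 e]
  have hA : A ∈ 𝓝 (e, w) :=
    prod_mem_nhds (ball_mem_nhds e hδ) (closedBall_mem_nhds w hη)
  filter_upwards [hA] with z hz t ht
  exact hΦ.forall_mem_of_return (lipschitzWith_frozenField hg) hT hstay hreturn hz ht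

theorem continuous_of_isGlobAsympStable [ProperSpace E] (hΦ : IsForwardFlow (frozenField g) Φ)
    (hg : LipschitzWith K fun z : E × W => g z.1 z.2) {lam : W → E}
    (he : ∀ w, IsGlobAsympStable (fun u => g u w) (lam w)) : Continuous lam := by
  refine continuous_iff_continuousAt.2 fun w => Metric.tendsto_nhds.2 fun ε hε => ?_
  have htrap := hΦ.eventually_forall_dist_lt hg (he w) (half_pos hε)
  filter_upwards [(Continuous.prodMk_right (lam w)).continuousAt.eventually htrap] with w' hw'
  -- The trapped trajectory with parameter `w'` converges to `lam w'`.
  have hlim : Tendsto (fun t => dist (Φ (lam w, w') t).1 (lam w)) atTop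
      (𝓝 (dist (lam w') (lam w))) :=
    ((he w').attractive _ ((hΦ.fst_isForwardFlow w').curve (lam w))).dist tendsto_const_nhds
  have hle : dist (lam w') (lam w) ≤ ε / 2 :=
    le_of_tendsto hlim ((eventually_ge_atTop 0).mono fun t ht => (hw' t ht).le)
  exact hle.trans_lt (half_lt_self hε)

theorem exists_forall_ge_dist_fst_lt [ProperSpace E] (hΦ : IsForwardFlow (frozenField g) Φ)
    (hg : LipschitzWith K fun z : E × W => g z.1 z.2) {lam : W → E}
    (he : ∀ w, IsGlobAsympStable (fun u => g u w) (lam w)) {C : Set (E × W)} (hC : IsCompact C)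
    {ε : ℝ} (hε : 0 < ε) : ∃ T, ∀ z ∈ C, ∀ t ≥ T, dist (Φ z t).1 (lam z.2) < ε := by
  have hF := lipschitzWith_frozenField hg
  refine hΦ.exists_forall_ge_mem hF (B := fun z => {z' | dist z'.1 (lam z.2) < ε}) hC ?_
  rintro ⟨u, w⟩ -
  have htrap := hΦ.eventually_forall_dist_lt hg (he w) (half_pos hε)
  obtain ⟨δ, hδ, hball⟩ := Metric.eventually_nhds_iff.1 htrap
  obtain ⟨T, hT, hu⟩ := (hΦ.fst_isForwardFlow w).exists_dist_lt (he w) u hδ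
  have hmem : dist (Φ (u, w) T) (lam w, w) < δ := by
    rw [Prod.dist_eq, hΦ.snd_eq (u, w) hT, dist_self]
    exact max_lt hu hδ
  have hcont : Continuous fun z : E × W => lam z.2 :=
    (hΦ.continuous_of_isGlobAsympStable hg he).comp continuous_snd
  have hlam : ∀ᶠ z : E × W in 𝓝 (u, w), dist (lam z.2) (lam w) < ε / 2 :=
    Metric.tendsto_nhds.1 (hcont.tendsto (u, w)) _ (half_pos hε)
  refine ⟨T, hT, ?_⟩
  filter_upwards [(hΦ.continuous_apply hF hT).continuousAt.eventually (isOpen_ball.mem_nhds hmem),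
    hlam] with z hz hzlam t ht
  have := hball hz t ht
  change dist (Φ (Φ z T) t).1 (lam z.2) < ε
  linarith [dist_triangle_right (Φ (Φ z T) t).1 (lam z.2) (lam w)]

end IsForwardFlow

end UniformAttraction

section GronwallBound

theorem gronwallBound_le_gronwallBound_of_le {δ δ' : ℝ} (h : δ ≤ δ') (K ε x : ℝ) :
    gronwallBound δ K ε x ≤ gronwallBound δ' K ε x := by
  unfold gronwallBound
  split_ifs
  · gcongr
  · gcongr

theorem gronwallBound_gronwallBound (δ K ε s t : ℝ) :
    gronwallBound (gronwallBound δ K ε s) K ε t = gronwallBound δ K ε (s + t) := by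
  rcases eq_or_ne K 0 with rfl | hK
  · simp only [gronwallBound_K0]
    ring
  · simp only [gronwallBound_of_K_ne_0 hK, mul_add, Real.exp_add]
    ring

end GronwallBound

section Tracking

/-- The time elapsed after `n` steps of sizes `a 0, a 1, …`. -/
noncomputable def elapsed (a : ℕ → ℝ) (n : ℕ) : ℝ := ∑ k ∈ Finset.range n, a k

theorem elapsed_succ (a : ℕ → ℝ) (n : ℕ) : elapsed a (n + 1) = elapsed a n + a n :=
  Finset.sum_range_succ a n

theorem elapsed_mono {a : ℕ → ℝ} (ha : ∀ n, 0 ≤ a n) : Monotone (elapsed a) :=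
  monotone_nat_of_le_succ fun n => by rw [elapsed_succ]; exact le_add_of_nonneg_right (ha n)

theorem exists_elapsed_window {a : ℕ → ℝ} (ha : Tendsto a atTop (𝓝 0))
    (hsum : Tendsto (elapsed a) atTop atTop) {T : ℝ} (hT : 0 ≤ T) (n₀ : ℕ) :
    ∀ᶠ m in atTop, ∃ n ≥ n₀, n ≤ m ∧ elapsed a m - elapsed a n ∈ Icc T (T + 1) := by
  obtain ⟨n₁, hn₁⟩ := eventually_atTop.1 (ha.eventually (gt_mem_nhds one_pos))
  set N := max n₀ n₁
  filter_upwards [hsum.eventually_ge_atTop (elapsed a N + T), eventually_ge_atTop N] with m hm hNm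
  classical
  set n := Nat.findGreatest (fun n => elapsed a n ≤ elapsed a m - T) m
  have hN : elapsed a N ≤ elapsed a m - T := by linarith
  have hn : elapsed a n ≤ elapsed a m - T :=
    Nat.findGreatest_spec (P := fun n => elapsed a n ≤ elapsed a m - T) hNm hN
  have hNn : N ≤ n := Nat.le_findGreatest hNm hN
  have hnm : n ≤ m := Nat.findGreatest_le m
  refine ⟨n, (le_max_left _ _).trans hNn, hnm, by linarith, ?_⟩
  rcases hnm.eq_or_lt with heq | hlt
  · rw [heq]; linarith
  · have hsucc := Nat.findGreatest_is_greatest (Nat.lt_succ_self n) hlt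
    rw [elapsed_succ, not_le] at hsucc
    linarith [hn₁ n ((le_max_right _ _).trans hNn)]

/-- Admissible step sizes of a stochastic approximation scheme, apart from the square summability
which only matters for the noise. -/
structure IsStepSize (a : ℕ → ℝ) : Prop where
  pos : ∀ n, 0 < a n
  tendsto_zero : Tendsto a atTop (𝓝 0)
  tendsto_elapsed : Tendsto (elapsed a) atTop atTop

section EulerScheme

variable {E : Type*} [NormedAddCommGroup E] [NormedSpace ℝ E] {F : E → E} {Φ : E → ℝ → E} {K : ℝ≥0}

namespace IsForwardFlow

theorem dist_euler_step_le (hΦ : IsForwardFlow F Φ) (hF : LipschitzWith K F) (z p ε : E)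
    {a ρ : ℝ} (ha : 0 ≤ a) (hρ : ‖ε‖ + K * (a * ‖F z + ε‖) ≤ ρ) :
    dist (z + a • (F z + ε)) (Φ p a) ≤ gronwallBound (dist z p) K ρ a := by
  set v := F z + ε
  have hline : ∀ t, HasDerivAt (fun t : ℝ => z + t • v) v t := fun t => by
    simpa using ((hasDerivAt_id t).smul_const v).const_add z
  have hdefect : ∀ t ∈ Ico 0 a, dist v (F (z + t • v)) ≤ ρ := fun t ht => by
    have hle : ‖F z - F (z + t • v)‖ ≤ K * (a * ‖v‖) := by
      refine (hF.norm_sub_le _ _).trans ?_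
      rw [sub_add_cancel_left, norm_neg, norm_smul, Real.norm_of_nonneg ht.1]
      have := ht.2.le
      gcongr
    calc dist v (F (z + t • v)) = ‖ε + (F z - F (z + t • v))‖ := by
          rw [dist_eq_norm]; congr 1; simp only [v]; abel
      _ ≤ ‖ε‖ + K * (a * ‖v‖) := (norm_add_le _ _).trans (by gcongr)
      _ ≤ ρ := hρ
  simpa using dist_le_of_approx_trajectories_ODE (v := fun _ => F) (εg := 0) (δ := dist z p)
    (fun _ => hF) (fun t _ => (hline t).continuousAt.continuousWithinAt)
    (fun t _ => (hline t).hasDerivWithinAt) hdefect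
    ((hΦ.continuousOn p).mono Icc_subset_Ici_self) (fun t ht => hΦ.hasDerivWithinAt_Ici p ht.1)
    (fun t _ => (dist_self _).le) (by simp [hΦ.init]) a ⟨ha, le_rfl⟩

variable {a : ℕ → ℝ} {z ε : ℕ → E}

theorem dist_euler_le (hΦ : IsForwardFlow F Φ) (hF : LipschitzWith K F) (ha : ∀ n, 0 ≤ a n)
    (hz : ∀ n, z (n + 1) = z n + a n • (F (z n) + ε n)) {n m : ℕ} (hnm : n ≤ m) {ρ : ℝ}
    (hρ : ∀ k ≥ n, ‖ε k‖ + K * (a k * ‖F (z k) + ε k‖) ≤ ρ) :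
    dist (z m) (Φ (z n) (elapsed a m - elapsed a n)) ≤
      gronwallBound 0 K ρ (elapsed a m - elapsed a n) := by
  induction m, hnm using Nat.le_induction with
  | base => simp [hΦ.init, gronwallBound_x0]
  | succ m hnm ih =>
    have hsub : 0 ≤ elapsed a m - elapsed a n := sub_nonneg.2 (elapsed_mono ha hnm)
    rw [elapsed_succ, add_sub_right_comm, hΦ.add hF _ hsub (ha m), hz m]
    calc _ ≤ gronwallBound _ K ρ (a m) := hΦ.dist_euler_step_le hF _ _ _ (ha m) (hρ m hnm)
      _ ≤ gronwallBound (gronwallBound 0 K ρ _) K ρ (a m) :=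
        gronwallBound_le_gronwallBound_of_le ih _ _ _
      _ = _ := gronwallBound_gronwallBound _ _ _ _ _

theorem eventually_forall_dist_euler_lt (hΦ : IsForwardFlow F Φ) (hF : LipschitzWith K F)
    (ha : ∀ n, 0 ≤ a n) (ha0 : Tendsto a atTop (𝓝 0))
    (hz : ∀ n, z (n + 1) = z n + a n • (F (z n) + ε n)) (hε : Tendsto ε atTop (𝓝 0)) {R : ℝ}
    (hR : ∀ n, ‖z n‖ ≤ R) (T : ℝ) {r : ℝ} (hr : 0 < r) :
    ∀ᶠ n in atTop, ∀ m ≥ n, elapsed a m - elapsed a n ≤ T →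
      dist (z m) (Φ (z n) (elapsed a m - elapsed a n)) < r := by
  have hbound : ∀ᶠ ρ in 𝓝[>] 0, gronwallBound 0 K ρ T < r :=
    (((gronwallBound_continuous_ε 0 K T).tendsto' 0 0 (gronwallBound_ε0_δ0 _ _)).mono_left
      nhdsWithin_le_nhds).eventually (gt_mem_nhds hr)
  obtain ⟨ρ, hρr, hρ⟩ := (hbound.and self_mem_nhdsWithin).exists
  have hFz : ∀ n, ‖F (z n)‖ ≤ ‖F 0‖ + K * R := fun n =>
    calc ‖F (z n)‖ ≤ ‖F 0‖ + ‖F (z n) - F 0‖ := norm_le_insert' _ _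
      _ ≤ ‖F 0‖ + K * R := by
        gcongr
        exact (hF.norm_sub_le _ _).trans (by rw [sub_zero]; gcongr; exact hR n)
  have hlim : Tendsto (fun n => ‖ε n‖ + K * (a n * (‖F 0‖ + K * R + ‖ε n‖))) atTop (𝓝 0) := by
    simpa using hε.norm.add ((ha0.mul (hε.norm.const_add (‖F 0‖ + K * R))).const_mul (K : ℝ))
  obtain ⟨n₀, hn₀⟩ := eventually_atTop.1 (hlim.eventually (gt_mem_nhds hρ))
  filter_upwards [eventually_ge_atTop n₀] with n hn m hnm hT
  refine (hΦ.dist_euler_le hF ha hz hnm fun k hk => ?_).trans_lt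
    ((gronwallBound_mono le_rfl hρ.le K.coe_nonneg hT).trans_lt hρr)
  refine le_trans ?_ (hn₀ k (hn.trans hk)).le
  have := ha k
  gcongr
  exact (norm_add_le _ _).trans (by gcongr; exact hFz k)

end IsForwardFlow

end EulerScheme

theorem tendsto_sub_of_isGlobAsympStable {E W : Type*} [NormedAddCommGroup E] [NormedSpace ℝ E]
    [ProperSpace E] [NormedAddCommGroup W] [NormedSpace ℝ W] [ProperSpace W] {g : E → W → E}
    {K : ℝ≥0} (hg : LipschitzWith K fun z : E × W => g z.1 z.2) {lam : W → E}
    (he : ∀ w, IsGlobAsympStable (fun u => g u w) (lam w)) {a : ℕ → ℝ} (ha : IsStepSize a)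
    {z ε : ℕ → E × W} (hz : ∀ n, z (n + 1) = z n + a n • (frozenField g (z n) + ε n))
    (hε : Tendsto ε atTop (𝓝 0)) {R : ℝ} (hR : ∀ n, ‖z n‖ ≤ R) :
    Tendsto (fun n => (z n).1 - lam (z n).2) atTop (𝓝 0) := by
  have hF := lipschitzWith_frozenField hg
  obtain ⟨Φ, hΦ⟩ := exists_isForwardFlow hF
  have hball : ∀ n, z n ∈ closedBall 0 R := fun n => mem_closedBall_zero_iff.2 (hR n)
  have hball' : ∀ n, (z n).2 ∈ closedBall 0 R := fun n =>
    mem_closedBall_zero_iff.2 ((le_max_right _ _).trans (hR n))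
  refine Metric.tendsto_nhds.2 fun r hr => ?_
  have hr3 : 0 < r / 3 := by positivity
  obtain ⟨T, hattract⟩ :=
    hΦ.exists_forall_ge_dist_fst_lt hg he (isCompact_closedBall (0 : E × W) R) hr3
  obtain ⟨η, hη, hlam⟩ := Metric.uniformContinuousOn_iff.1
    ((isCompact_closedBall (0 : W) R).uniformContinuousOn_of_continuous
      (hΦ.continuous_of_isGlobAsympStable hg he).continuousOn) (r / 3) hr3
  obtain ⟨n₀, htrack⟩ := eventually_atTop.1 <| hΦ.eventually_forall_dist_euler_lt hF
    (fun n => (ha.pos n).le) ha.tendsto_zero hz hε hR (max T 0 + 1) (lt_min hr3 hη)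
  filter_upwards [exists_elapsed_window ha.tendsto_zero ha.tendsto_elapsed (le_max_right T 0) n₀]
    with m ⟨n, hn, hnm, hT, hT'⟩
  set t := elapsed a m - elapsed a n
  have ht : 0 ≤ t := (le_max_right _ _).trans hT
  obtain ⟨hfst, hsnd⟩ := max_lt_iff.1 (Prod.dist_eq.symm.trans_lt (htrack n hn m hnm hT'))
  rw [hΦ.snd_eq _ ht] at hsnd
  rw [dist_zero_right, ← dist_eq_norm]
  calc dist (z m).1 (lam (z m).2) ≤ dist (z m).1 (Φ (z n) t).1 + dist (Φ (z n) t).1 (lam (z n).2)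
        + dist (lam (z n).2) (lam (z m).2) := dist_triangle4 _ _ _ _
    _ < r / 3 + r / 3 + r / 3 := by
      gcongr
      · exact hfst.trans_le (min_le_left _ _)
      · exact hattract _ (hball n) t ((le_max_left _ _).trans hT)
      · rw [dist_comm]
        exact hlam _ (hball' m) _ (hball' n) (hsnd.trans_le (min_le_right _ _))
    _ = r := by ring

end Tracking

section Noise

variable {Ω : Type*} [mΩ : MeasurableSpace Ω] {P : Measure Ω}

theorem lintegral_enorm_sq_eq_ofReal_integral {f : Ω → ℝ} (hf : MemLp f 2 P) :
    ∫⁻ ω, ‖f ω‖ₑ ^ 2 ∂P = ENNReal.ofReal (∫ ω, f ω ^ 2 ∂P) := by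
  rw [ofReal_integral_eq_lintegral_ofReal hf.integrable_sq (ae_of_all _ fun _ => sq_nonneg _)]
  exact lintegral_congr fun ω => by rw [← enorm_pow, Real.enorm_of_nonneg (sq_nonneg _)]

theorem eLpNorm_two_eq_lintegral_rpow {E : Type*} [NormedAddCommGroup E] (f : Ω → E) :
    eLpNorm f 2 P = (∫⁻ ω, ‖f ω‖ₑ ^ 2 ∂P) ^ (2⁻¹ : ℝ) := by
  simp [eLpNorm_eq_lintegral_rpow_enorm_toReal two_ne_zero ENNReal.ofNat_ne_top]

theorem memLp_two_of_lintegral_enorm_sq_ne_top {E : Type*} [NormedAddCommGroup E] {f : Ω → E}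
    (hf : AEStronglyMeasurable f P) (h : ∫⁻ ω, ‖f ω‖ₑ ^ 2 ∂P ≠ ∞) : MemLp f 2 P := by
  refine ⟨hf, ?_⟩
  rw [eLpNorm_two_eq_lintegral_rpow]
  exact ENNReal.rpow_lt_top_of_nonneg (by positivity) h

variable [IsFiniteMeasure P] {ℱ : Filtration ℕ mΩ}

section MartingaleDifference

variable {ξ : ℕ → Ω → ℝ}

theorem stronglyAdapted_sum (hmeas : ∀ k, StronglyMeasurable[ℱ (k + 1)] (ξ k)) :
    StronglyAdapted ℱ fun n => ∑ k ∈ Finset.range n, ξ k := fun _ =>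
  Finset.stronglyMeasurable_sum _ fun k hk =>
    (hmeas k).mono (ℱ.mono (Nat.succ_le_of_lt (Finset.mem_range.1 hk)))

theorem martingale_sum (hmeas : ∀ k, StronglyMeasurable[ℱ (k + 1)] (ξ k))
    (hint : ∀ k, Integrable (ξ k) P) (hmart : ∀ k, P[ξ k | ℱ k] =ᵐ[P] 0) :
    Martingale (fun n => ∑ k ∈ Finset.range n, ξ k) ℱ P :=
  martingale_of_condExp_sub_eq_zero_nat (stronglyAdapted_sum hmeas)
    (fun _ => integrable_finsetSum' _ fun k _ => hint k)
    fun n => by rw [Finset.sum_range_succ, add_sub_cancel_left]; exact hmart n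

theorem integral_mul_eq_zero_of_condExp_eq_zero {m : MeasurableSpace Ω} (hm : m ≤ mΩ)
    {f g : Ω → ℝ} (hf : StronglyMeasurable[m] f) (hfL2 : MemLp f 2 P) (hgL2 : MemLp g 2 P)
    (hg : P[g | m] =ᵐ[P] 0) : ∫ ω, f ω * g ω ∂P = 0 := by
  have hpull : P[f * g | m] =ᵐ[P] f * P[g | m] :=
    condExp_mul_of_stronglyMeasurable_left hf (hfL2.integrable_mul hgL2)
      (hgL2.integrable one_le_two)
  have hzero : P[f * g | m] =ᵐ[P] 0 := by
    filter_upwards [hpull, hg] with ω hω hgω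
    simp [hω, hgω]
  calc ∫ ω, f ω * g ω ∂P = ∫ ω, (P[f * g | m]) ω ∂P := (integral_condExp hm).symm
    _ = 0 := by simp [integral_congr_ae hzero]

theorem lintegral_enorm_sum_sq (hmeas : ∀ k, StronglyMeasurable[ℱ (k + 1)] (ξ k))
    (hL2 : ∀ k, MemLp (ξ k) 2 P) (hmart : ∀ k, P[ξ k | ℱ k] =ᵐ[P] 0) (n : ℕ) :
    ∫⁻ ω, ‖(∑ k ∈ Finset.range n, ξ k) ω‖ₑ ^ 2 ∂P =
      ∑ k ∈ Finset.range n, ∫⁻ ω, ‖ξ k ω‖ₑ ^ 2 ∂P := by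
  induction n with
  | zero => simp
  | succ n ih =>
    set S := ∑ k ∈ Finset.range n, ξ k
    have hS : MemLp S 2 P := memLp_finsetSum' _ fun k _ => hL2 k
    have horth : ∫ ω, S ω * ξ n ω ∂P = 0 :=
      integral_mul_eq_zero_of_condExp_eq_zero (ℱ.le n) (stronglyAdapted_sum hmeas n) hS (hL2 n)
        (hmart n)
    have hcross : Integrable (fun ω => 2 * (S ω * ξ n ω)) P :=
      (hS.integrable_mul (hL2 n)).const_mul 2
    have hrest : Integrable (fun ω => 2 * (S ω * ξ n ω) + ξ n ω ^ 2) P :=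
      hcross.add (hL2 n).integrable_sq
    have hpyth : ∫ ω, (S + ξ n) ω ^ 2 ∂P = ∫ ω, S ω ^ 2 ∂P + ∫ ω, ξ n ω ^ 2 ∂P := by
      have hexp : ∀ ω, (S + ξ n) ω ^ 2 = S ω ^ 2 + (2 * (S ω * ξ n ω) + ξ n ω ^ 2) := fun ω => by
        rw [Pi.add_apply]; ring
      simp_rw [hexp]
      rw [integral_add hS.integrable_sq hrest, integral_add hcross (hL2 n).integrable_sq,
        integral_const_mul, horth, mul_zero, zero_add]
    rw [Finset.sum_range_succ, Finset.sum_range_succ, ← ih,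
      lintegral_enorm_sq_eq_ofReal_integral (hS.add (hL2 n)), hpyth,
      ENNReal.ofReal_add (integral_nonneg fun _ => sq_nonneg _)
        (integral_nonneg fun _ => sq_nonneg _),
      lintegral_enorm_sq_eq_ofReal_integral hS, lintegral_enorm_sq_eq_ofReal_integral (hL2 n)]

theorem ae_exists_tendsto_sum_of_tsum_lintegral_ne_top_real
    (hmeas : ∀ k, StronglyMeasurable[ℱ (k + 1)] (ξ k))
    (hmart : ∀ k, P[ξ k | ℱ k] =ᵐ[P] 0) (hsum : ∑' k, ∫⁻ ω, ‖ξ k ω‖ₑ ^ 2 ∂P ≠ ∞) :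
    ∀ᵐ ω ∂P, ∃ s, Tendsto (fun n => ∑ k ∈ Finset.range n, ξ k ω) atTop (𝓝 s) := by
  have hL2 : ∀ k, MemLp (ξ k) 2 P := fun k =>
    memLp_two_of_lintegral_enorm_sq_ne_top ((hmeas k).mono (ℱ.le _)).aestronglyMeasurable
      (ENNReal.ne_top_of_tsum_ne_top hsum k)
  have hM := martingale_sum hmeas (fun k => (hL2 k).integrable one_le_two) hmart
  set R := (∑' k, ∫⁻ ω, ‖ξ k ω‖ₑ ^ 2 ∂P) ^ (2⁻¹ : ℝ) * P univ ^ (2⁻¹ : ℝ)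
  have hR : R ≠ ∞ := ENNReal.mul_ne_top (ENNReal.rpow_ne_top_of_nonneg (by norm_num) hsum)
    (ENNReal.rpow_ne_top_of_nonneg (by norm_num) (measure_ne_top P univ))
  have hbdd : ∀ n, eLpNorm (∑ k ∈ Finset.range n, ξ k) 1 P ≤ R.toNNReal := fun n => by
    have hexp : 1 / (1 : ℝ≥0∞).toReal - 1 / (2 : ℝ≥0∞).toReal = 2⁻¹ := by norm_num
    have hle := eLpNorm_le_eLpNorm_mul_rpow_measure_univ one_le_two
      (memLp_finsetSum' (Finset.range n) fun k _ => hL2 k).aestronglyMeasurable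
    rw [hexp, eLpNorm_two_eq_lintegral_rpow, lintegral_enorm_sum_sq hmeas hL2 hmart n] at hle
    rw [ENNReal.coe_toNNReal hR]
    exact hle.trans (mul_le_mul'
      (ENNReal.rpow_le_rpow (ENNReal.sum_le_tsum _) (by norm_num)) le_rfl)
  filter_upwards [hM.submartingale.exists_ae_tendsto_of_bdd hbdd] with ω hω
  simpa using hω

end MartingaleDifference

section Vector

variable {E : Type*} [NormedAddCommGroup E] [NormedSpace ℝ E] [FiniteDimensional ℝ E]
  {ξ : ℕ → Ω → E}

theorem ae_exists_tendsto_sum_of_tsum_lintegral_ne_top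
    (hmeas : ∀ k, StronglyMeasurable[ℱ (k + 1)] (ξ k)) (hint : ∀ k, Integrable (ξ k) P)
    (hmart : ∀ k, P[ξ k | ℱ k] =ᵐ[P] 0) (hsum : ∑' k, ∫⁻ ω, ‖ξ k ω‖ₑ ^ 2 ∂P ≠ ∞) :
    ∀ᵐ ω ∂P, ∃ s, Tendsto (fun n => ∑ k ∈ Finset.range n, ξ k ω) atTop (𝓝 s) := by
  let e := (Module.finBasis ℝ E).equivFunL
  have hcoord (l) : ∀ᵐ ω ∂P,
      ∃ s, Tendsto (fun n => ∑ k ∈ Finset.range n, e (ξ k ω) l) atTop (𝓝 s) := by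
    let π : E →L[ℝ] ℝ := (ContinuousLinearMap.proj l).comp e.toContinuousLinearMap
    refine ae_exists_tendsto_sum_of_tsum_lintegral_ne_top_real (ξ := fun k ω => π (ξ k ω))
      (fun k => π.continuous.comp_stronglyMeasurable (hmeas k)) (fun k => ?_) ?_
    · filter_upwards [π.comp_condExp_comm (hint k) (m := ℱ k), hmart k] with ω hπ hω
      rw [Function.comp_apply, hω, Pi.zero_apply, map_zero] at hπ
      exact hπ.symm
    · refine ne_top_of_le_ne_top
        (ENNReal.mul_ne_top (ENNReal.pow_ne_top (n := 2) (enorm_ne_top (x := π))) hsum) ?_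
      rw [← ENNReal.tsum_mul_left]
      refine ENNReal.tsum_le_tsum fun k => ?_
      rw [← lintegral_const_mul' _ _ (ENNReal.pow_ne_top enorm_ne_top)]
      refine lintegral_mono fun ω => ?_
      rw [← mul_pow]
      gcongr
      exact π.le_opENorm _
  filter_upwards [ae_all_iff.2 hcoord] with ω hω
  choose s hs using hω
  refine ⟨e.symm s, ((e.symm.continuous.tendsto s).comp (tendsto_pi_nhds.2 hs)).congr fun n => ?_⟩
  rw [Function.comp_apply, e.symm_apply_eq, map_sum]
  ext l
  rw [Finset.sum_apply]

theorem ae_bddAbove_imp_exists_tendsto_sum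
    (hmeas : ∀ k, StronglyMeasurable[ℱ (k + 1)] (ξ k)) (hint : ∀ k, Integrable (ξ k) P)
    (hmart : ∀ k, P[ξ k | ℱ k] =ᵐ[P] 0) {X : ℕ → Ω → ℝ} (hX : ∀ k, Measurable[ℱ k] (X k))
    (hsum : ∀ c : ℕ, ∑' k, ∫⁻ ω in {ω | X k ω ≤ c}, ‖ξ k ω‖ₑ ^ 2 ∂P ≠ ∞) :
    ∀ᵐ ω ∂P, BddAbove (range fun k => X k ω) →
      ∃ s, Tendsto (fun n => ∑ k ∈ Finset.range n, ξ k ω) atTop (𝓝 s) := by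
  have hA (c : ℕ) (k) : MeasurableSet[ℱ k] {ω | X k ω ≤ c} := hX k measurableSet_Iic
  have hconv (c : ℕ) : ∀ᵐ ω ∂P, ∃ s, Tendsto
      (fun n => ∑ k ∈ Finset.range n, {ω | X k ω ≤ c}.indicator (ξ k) ω) atTop (𝓝 s) := by
    refine ae_exists_tendsto_sum_of_tsum_lintegral_ne_top
      (fun k => (hmeas k).indicator (ℱ.mono k.le_succ _ (hA c k)))
      (fun k => (hint k).indicator (ℱ.le k _ (hA c k))) (fun k => ?_) ?_
    · filter_upwards [condExp_indicator (hint k) (hA c k), hmart k] with ω hind hω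
      rw [hind, Set.indicator_apply, hω, Pi.zero_apply, ite_self]
    · convert hsum c using 3 with k
      rw [← lintegral_indicator (ℱ.le k _ (hA c k))]
      refine lintegral_congr fun ω => ?_
      by_cases hω : ω ∈ {ω | X k ω ≤ c} <;> simp [hω]
  filter_upwards [ae_all_iff.2 hconv] with ω hω ⟨b, hb⟩
  obtain ⟨c, hc⟩ := exists_nat_ge b
  refine (hω c).imp fun s hs => hs.congr fun n => Finset.sum_congr rfl fun k _ => ?_
  exact Set.indicator_of_mem (s := {ω | X k ω ≤ c}) ((hb ⟨k, rfl⟩).trans hc) _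

end Vector

theorem setLIntegral_le_of_condLExp_le {m : MeasurableSpace Ω} (hm : m ≤ mΩ) {f : Ω → ℝ≥0∞}
    {A : Set Ω} (hA : MeasurableSet[m] A) {c : ℝ≥0∞} (hc : ∀ᵐ ω ∂P, ω ∈ A → condLExp m P f ω ≤ c) :
    ∫⁻ ω in A, f ω ∂P ≤ c * P A := by
  rw [← setLIntegral_condLExp hm P f hA, ← setLIntegral_const]
  exact setLIntegral_mono_ae' (hm A hA) hc

theorem ae_bddAbove_imp_exists_tendsto_sum_smul {E : Type*} [NormedAddCommGroup E]
    [NormedSpace ℝ E] [FiniteDimensional ℝ E] {α : ℕ → ℝ} (hα : Summable fun k => α k ^ 2)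
    {M : ℕ → Ω → E} (hmeas : ∀ k, StronglyMeasurable[ℱ (k + 1)] (M k))
    (hint : ∀ k, Integrable (M k) P) (hmart : ∀ k, P[M k | ℱ k] =ᵐ[P] 0)
    {X : ℕ → Ω → ℝ} (hX : ∀ k, Measurable[ℱ k] (X k))
    (hvar : ∀ k, ∀ᵐ ω ∂P,
      condLExp (ℱ k) P (fun ω => ‖M k ω‖ₑ ^ 2) ω ≤ ENNReal.ofReal (X k ω)) :
    ∀ᵐ ω ∂P, BddAbove (range fun k => X k ω) →
      ∃ s, Tendsto (fun n => ∑ k ∈ Finset.range n, α k • M k ω) atTop (𝓝 s) := by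
  refine ae_bddAbove_imp_exists_tendsto_sum (ξ := fun k => α k • M k)
    (fun k => (hmeas k).const_smul (α k)) (fun k => (hint k).smul (α k)) (fun k => ?_) hX
    fun c => ?_
  · filter_upwards [condExp_smul (α k) (M k) (ℱ k), hmart k] with ω hsmul hω
    rw [hsmul, Pi.smul_apply, hω, Pi.zero_apply, smul_zero]
  · have hM (k) : ∫⁻ ω in {ω | X k ω ≤ c}, ‖M k ω‖ₑ ^ 2 ∂P ≤
        ENNReal.ofReal c * P univ :=
      (setLIntegral_le_of_condLExp_le (ℱ.le k) (hX k measurableSet_Iic)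
        ((hvar k).mono fun ω hω hωc => hω.trans (ENNReal.ofReal_le_ofReal hωc))).trans
        (by gcongr; exact subset_univ _)
    have hξ (k) : ∫⁻ ω in {ω | X k ω ≤ c}, ‖(α k • M k) ω‖ₑ ^ 2 ∂P ≤
        ENNReal.ofReal (α k ^ 2) * (ENNReal.ofReal c * P univ) := by
      have hsq : ENNReal.ofReal (α k ^ 2) = ‖α k‖ₑ ^ 2 := by
        rw [← enorm_pow, Real.enorm_of_nonneg (sq_nonneg _)]
      simp_rw [Pi.smul_apply, enorm_smul, mul_pow]
      rw [lintegral_const_mul' _ _ (ENNReal.pow_ne_top enorm_ne_top), hsq]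
      gcongr
      exact hM k
    refine ne_top_of_le_ne_top ?_ (ENNReal.tsum_le_tsum hξ)
    rw [ENNReal.tsum_mul_right]
    exact ENNReal.mul_ne_top hα.tsum_ofReal_ne_top
      (ENNReal.mul_ne_top ENNReal.ofReal_ne_top (measure_ne_top P univ))

end Noise

section Nest

variable {N : ℕ} {d : Fin N → ℕ} {h : ∀ j : Fin N, State d → Block d j}
  {lam : ∀ i : Fin N, SlowerState d i → Block d i}

theorem exists_lipschitzWith_pi {ι X : Type*} {Y : ι → Type*} [Fintype ι] [PseudoEMetricSpace X]
    [∀ i, PseudoEMetricSpace (Y i)] {f : ∀ i, X → Y i} (hf : ∀ i, ∃ L, LipschitzWith L (f i)) :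
    ∃ L, LipschitzWith L fun x i => f i x := by
  choose L hL using hf
  exact ⟨Finset.univ.sup L, fun x y => edist_pi_le_iff.2 fun i =>
    (hL i).weaken (Finset.le_sup (Finset.mem_univ i)) x y⟩

theorem exists_lipschitzWith_nest {i : Fin N} (hlam : ∀ j < i, ∃ L, LipschitzWith L (lam j)) :
    ∃ L, LipschitzWith L (nest lam i) := by
  refine exists_lipschitzWith_pi (f := fun j x => nest lam i x j) fun j => ?_
  induction j using WellFoundedGT.induction with
  | _ j ih =>
    rcases lt_or_ge j i with hj | hj
    · obtain ⟨L, hL⟩ := hlam j hj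
      obtain ⟨C, hC⟩ := exists_lipschitzWith_pi
        (f := fun (k : {k : Fin N // j < k}) x => nest lam i x k.1) fun k => ih k.1 k.2
      refine ⟨L * C, ?_⟩
      simp_rw [nest_of_lt lam _ hj]
      exact hL.comp hC
    · refine ⟨1, ?_⟩
      simp_rw [nest_of_le lam _ hj]
      exact LipschitzWith.eval j

theorem nest_congr {i : Fin N} {x y : State d} (hxy : ∀ k ≥ i, x k = y k) :
    nest lam i x = nest lam i y := by
  funext j
  induction j using WellFoundedGT.induction with
  | _ j ih =>
    rcases lt_or_ge j i with hj | hj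
    · rw [nest_of_lt lam x hj, nest_of_lt lam y hj]
      exact congrArg (lam j) (funext fun k => ih k.1 k.2)
    · rw [nest_of_le lam x hj, nest_of_le lam y hj, hxy j hj]

/-- The joint parameter with prescribed entries slower than `i`, completed by zeros. It turns
`limitField h lam i`, whose frozen argument is a whole `State d`, into a field on
`Block d i × SlowerState d i`. -/
noncomputable def extendSlower (i : Fin N) (w : SlowerState d i) : State d :=
  fun k => if hk : i < k then w ⟨k, hk⟩ else 0

theorem extendSlower_of_lt {i k : Fin N} (w : SlowerState d i) (hk : i < k) :
    extendSlower i w k = w ⟨k, hk⟩ := dif_pos hk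

theorem limitField_extendSlower (i : Fin N) (x : State d) :
    limitField h lam i (extendSlower i fun k => x k.1) (x i) = h i (nest lam i x) := by
  refine congrArg (h i) (nest_congr fun k hk => ?_)
  rcases hk.eq_or_lt with rfl | hk
  · exact Function.update_self ..
  · rw [Function.update_of_ne hk.ne', extendSlower_of_lt _ hk]

theorem lipschitzWith_update_extendSlower (i : Fin N) :
    LipschitzWith 1 fun z : Block d i × SlowerState d i =>
      Function.update (extendSlower i z.2) i z.1 := fun z z' => by
  rw [ENNReal.coe_one, one_mul, edist_pi_le_iff]
  intro k
  beta_reduce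
  rcases lt_trichotomy i k with hk | rfl | hk
  · rw [Function.update_of_ne hk.ne', Function.update_of_ne hk.ne', extendSlower_of_lt _ hk,
      extendSlower_of_lt _ hk]
    exact (edist_le_pi_edist z.2 z'.2 ⟨k, hk⟩).trans (le_max_right _ _)
  · rw [Function.update_self, Function.update_self]
    exact le_max_left _ _
  · rw [Function.update_of_ne hk.ne, Function.update_of_ne hk.ne, extendSlower, extendSlower,
      dif_neg hk.asymm, dif_neg hk.asymm, edist_self]
    exact zero_le

theorem exists_lipschitzWith_limitField {i : Fin N} (hh : ∃ L, LipschitzWith L (h i))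
    (hlam : ∀ j < i, ∃ L, LipschitzWith L (lam j)) :
    ∃ K, LipschitzWith K fun z : Block d i × SlowerState d i =>
      limitField h lam i (extendSlower i z.2) z.1 := by
  obtain ⟨L, hL⟩ := hh
  obtain ⟨C, hC⟩ := exists_lipschitzWith_nest hlam
  exact ⟨L * (C * 1), hL.comp (hC.comp (lipschitzWith_update_extendSlower i))⟩

variable [NeZero N]

theorem nest_top (x : State d) (j : Fin N) : nest lam ⊤ x j = lamTo lam j (x ⊤) := by
  refine congrFun (nest_congr fun k hk => ?_) j
  obtain rfl := top_le_iff.1 hk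
  exact (Function.update_self ..).symm

theorem lamTo_top (v : Block d ⊤) : lamTo lam ⊤ v = v := by
  rw [lamTo, nest_of_le lam _ le_rfl, Function.update_self]

theorem continuous_lamTo (hlam : ∀ i < ⊤, ∃ L, LipschitzWith L (lam i)) (j : Fin N) :
    Continuous (lamTo lam j) := by
  obtain ⟨L, hL⟩ := exists_lipschitzWith_nest hlam
  exact (continuous_apply j).comp (hL.continuous.comp (continuous_const.update ⊤ continuous_id))

end Nest

section StepSize

theorem tendsto_zero_of_summable_sq {a : ℕ → ℝ} (ha : Summable fun n => a n ^ 2) :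
    Tendsto a atTop (𝓝 0) := by
  have hsqrt := ha.tendsto_atTop_zero.sqrt
  simp only [Real.sqrt_sq_eq_abs, Real.sqrt_zero] at hsqrt
  exact (tendsto_zero_iff_abs_tendsto_zero _).2 hsqrt

theorem tendsto_div_of_lt_of_forall_covBy {ι κ : Type*} [PartialOrder ι] [SuccOrder ι]
    [IsSuccArchimedean ι] {l : Filter κ} {α : ι → κ → ℝ} (hα : ∀ i n, α i n ≠ 0)
    (hratio : ∀ i j, i ⋖ j → Tendsto (fun n => α j n / α i n) l (𝓝 0)) {i k : ι} (hik : i < k) :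
    Tendsto (fun n => α k n / α i n) l (𝓝 0) := by
  let r (i j : ι) : Prop := Tendsto (fun n => α j n / α i n) l (𝓝 0)
  have : IsTrans ι r := ⟨fun i j k hij hjk => by
    simpa only [div_mul_div_cancel₀ (hα j _), mul_zero] using Tendsto.mul hjk hij⟩
  have hgen := transGen_of_succ_of_lt r (fun j hj => hratio j _
    (Order.covBy_succ_of_not_isMax (hj.2.not_isMax))) hik
  rwa [Relation.transGen_eq_self] at hgen

/-- Step size sequences for the timescales `Fin N`, where larger indices are infinitely slower than
smaller ones. -/
structure IsTimescaleSeparated {N : ℕ} (α : Fin N → ℕ → ℝ) : Prop where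
  isStepSize : ∀ j, IsStepSize (α j)
  tendsto_div : ∀ i k, i < k → Tendsto (fun n => α k n / α i n) atTop (𝓝 0)

theorem isTimescaleSeparated_of_summable {N : ℕ} {α : Fin N → ℕ → ℝ} (hpos : ∀ j n, 0 < α j n)
    (hsum : ∀ j, Tendsto (elapsed (α j)) atTop atTop) (hsq : ∀ j, Summable fun n => α j n ^ 2)
    (hratio : ∀ i j : Fin N, i.val + 1 = j.val → Tendsto (fun n => α j n / α i n) atTop (𝓝 0)) :
    IsTimescaleSeparated α where
  isStepSize j := ⟨hpos j, tendsto_zero_of_summable_sq (hsq j), hsum j⟩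
  tendsto_div _ _ := tendsto_div_of_lt_of_forall_covBy (fun j n => (hpos j n).ne') fun i j hij =>
    hratio i j (Order.covBy_iff_add_one_eq.1 (Fin.covBy_iff.1 hij))

end StepSize

section Levels

variable {N : ℕ} {d : Fin N → ℕ} {h : ∀ j : Fin N, State d → Block d j}
  {lam : ∀ i : Fin N, SlowerState d i → Block d i} {α : Fin N → ℕ → ℝ} {x ε : ℕ → State d} {R : ℝ}

theorem tendsto_sub_zero_of_uniformContinuous {ι E F : Type*} [UniformSpace E] [AddGroup E]
    [IsRightUniformAddGroup E] [UniformSpace F] [AddGroup F] [IsRightUniformAddGroup F]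
    {f : E → F} (hf : UniformContinuous f) {l : Filter ι} {u v : ι → E}
    (huv : Tendsto (fun i => u i - v i) l (𝓝 0)) :
    Tendsto (fun i => f (u i) - f (v i)) l (𝓝 0) := by
  have hunif : Tendsto (fun i => (v i, u i)) l (uniformity E) := by
    rwa [uniformity_eq_comap_nhds_zero, tendsto_comap_iff]
  have himage := Tendsto.comp hf hunif
  rwa [uniformity_eq_comap_nhds_zero, tendsto_comap_iff] at himage

theorem tendsto_sub_nest {i : Fin N} (hlam : ∀ j < i, ∃ L, LipschitzWith L (lam j))
    (hfast : ∀ j < i, Tendsto (fun n => x n j - lam j fun k => x n k.1) atTop (𝓝 0)) :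
    Tendsto (fun n => x n - nest lam i (x n)) atTop (𝓝 0) := by
  refine tendsto_pi_nhds.2 fun j => ?_
  simp_rw [Pi.sub_apply, Pi.zero_apply]
  induction j using WellFoundedGT.induction with
  | _ j ih =>
    rcases lt_or_ge j i with hj | hj
    · obtain ⟨L, hL⟩ := hlam j hj
      have hslower : Tendsto (fun n => lam j (fun k => x n k.1) -
          lam j fun k => nest lam i (x n) k.1) atTop (𝓝 0) :=
        tendsto_sub_zero_of_uniformContinuous hL.uniformContinuous
          (tendsto_pi_nhds.2 fun k => ih k.1 k.2)
      simpa only [nest_of_lt lam _ hj, sub_add_sub_cancel, add_zero] using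
        (hfast j hj).add hslower
    · simp only [nest_of_le lam _ hj, sub_self, tendsto_const_nhds]

theorem tendsto_smul_map_add_of_bounded {E F : Type*} [SeminormedAddCommGroup E]
    [SeminormedAddCommGroup F] [NormedSpace ℝ F] {f : E → F} (hf : ∃ L, LipschitzWith L f)
    {u : ℕ → E} (hu : ∀ n, ‖u n‖ ≤ R) {η : ℕ → F} (hη : Tendsto η atTop (𝓝 0)) {c : ℕ → ℝ}
    (hc : Tendsto c atTop (𝓝 0)) : Tendsto (fun n => c n • (f (u n) + η n)) atTop (𝓝 0) := by
  obtain ⟨L, hL⟩ := hf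
  obtain ⟨B, hB⟩ := (hL.isBounded_image (isBounded_closedBall (x := 0) (r := R))).exists_norm_le
  have hbdd : IsBoundedUnder (· ≤ ·) atTop (norm ∘ fun n => f (u n)) :=
    isBoundedUnder_of ⟨B, fun n => hB _ (mem_image_of_mem f (mem_closedBall_zero_iff.2 (hu n)))⟩
  simpa only [smul_add, smul_zero, add_zero] using
    (hc.zero_smul_isBoundedUnder_le hbdd).add (hc.smul hη)

theorem tendsto_sub_of_tendsto_sub_faster (hh : ∀ j, ∃ L, LipschitzWith L (h j))
    (hα : IsTimescaleSeparated α)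
    (hx : ∀ n j, x (n + 1) j = x n j + α j n • (h j (x n) + ε n j))
    (hε : Tendsto ε atTop (𝓝 0)) (hR : ∀ n, ‖x n‖ ≤ R)
    {i : Fin N} (hlam : ∀ j < i, ∃ L, LipschitzWith L (lam j))
    (hfast : ∀ j < i, Tendsto (fun n => x n j - lam j fun k => x n k.1) atTop (𝓝 0))
    {e : SlowerState d i → Block d i}
    (he : ∀ w, IsGlobAsympStable (limitField h lam i (extendSlower i w)) (e w)) :
    Tendsto (fun n => x n i - e fun k => x n k.1) atTop (𝓝 0) := by
  obtain ⟨K, hK⟩ := exists_lipschitzWith_limitField (hh i) hlam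
  have hR₀ : 0 ≤ R := (norm_nonneg _).trans (hR 0)
  have hxR (n k) : ‖x n k‖ ≤ R := (norm_le_pi_norm (x n) k).trans (hR n)
  refine tendsto_sub_of_isGlobAsympStable
    (g := fun u w => limitField h lam i (extendSlower i w) u) hK he (hα.isStepSize i)
    (z := fun n => (x n i, fun k => x n k.1))
    (ε := fun n => (h i (x n) - h i (nest lam i (x n)) + ε n i,
      fun k => (α k.1 n / α i n) • (h k.1 (x n) + ε n k.1)))
    (fun n => Prod.ext ?_ (funext fun k => ?_)) (Tendsto.prodMk_nhds ?_ ?_) (R := R)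
    fun n => norm_prod_le_iff.2 ⟨hxR n i, (pi_norm_le_iff_of_nonneg hR₀).2 fun k => hxR n k.1⟩
  · simp only [frozenField, Prod.fst_add, Prod.smul_fst]
    rw [limitField_extendSlower, hx n i, ← add_assoc, add_sub_cancel]
  · simp only [frozenField, Prod.snd_add, Prod.smul_snd, Pi.add_apply, Pi.smul_apply, zero_add]
    rw [hx n k.1, smul_smul, mul_div_cancel₀ _ ((hα.isStepSize i).pos n).ne']
  · obtain ⟨L, hL⟩ := hh i
    simpa using (tendsto_sub_zero_of_uniformContinuous hL.uniformContinuous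
      (tendsto_sub_nest hlam hfast)).add (tendsto_pi_nhds.1 hε i)
  · exact tendsto_pi_nhds.2 fun k => tendsto_smul_map_add_of_bounded (hh k.1) hR
      (tendsto_pi_nhds.1 hε k.1) (hα.tendsto_div i k.1 k.2)

variable [NeZero N]

theorem tendsto_lamTo_of_tendsto_error (hh : ∀ j, ∃ L, LipschitzWith L (h j))
    (hα : IsTimescaleSeparated α)
    (hx : ∀ n j, x (n + 1) j = x n j + α j n • (h j (x n) + ε n j))
    (hε : Tendsto ε atTop (𝓝 0)) (hR : ∀ n, ‖x n‖ ≤ R)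
    (hlamLip : ∀ i < ⊤, ∃ L, LipschitzWith L (lam i))
    (hlam : ∀ i < ⊤, ∀ z : State d,
      IsGlobAsympStable (limitField h lam i z) (lam i fun k => z k.1))
    {xstar : Block d ⊤} (hxstar : IsGlobAsympStable (limitField h lam ⊤ 0) xstar) (j : Fin N) :
    Tendsto (fun n => x n j) atTop (𝓝 (lamTo lam j xstar)) := by
  have hlevel : ∀ i < ⊤, Tendsto (fun n => x n i - lam i fun k => x n k.1) atTop (𝓝 0) := by
    intro i hi
    induction i using WellFoundedLT.induction with
    | _ i ih =>
      refine tendsto_sub_of_tendsto_sub_faster hh hα hx hε hR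
        (fun j hj => hlamLip j (hj.trans hi)) (fun j hj => ih j hj (hj.trans hi)) fun w => ?_
      simpa only [extendSlower_of_lt w (Subtype.prop _)] using hlam i hi (extendSlower i w)
  have htop : Tendsto (fun n => x n ⊤) atTop (𝓝 xstar) := by
    have hsub := tendsto_sub_of_tendsto_sub_faster hh hα hx hε hR hlamLip hlevel
      (e := fun _ => xstar) fun w => by
        rwa [show extendSlower ⊤ w = 0 from funext fun k => dif_neg not_top_lt]
    simpa only [sub_add_cancel, zero_add] using hsub.add_const xstar
  have hnest := tendsto_pi_nhds.1 (tendsto_sub_nest hlamLip hlevel) j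
  simp only [Pi.sub_apply, nest_top, Pi.zero_apply] at hnest
  have hlamTo := ((continuous_lamTo hlamLip j).tendsto xstar).comp htop
  simpa only [Function.comp_apply, sub_add_cancel, zero_add] using hnest.add hlamTo

theorem tendsto_lamTo_of_tendsto_noise (hh : ∀ j, ∃ L, LipschitzWith L (h j))
    (hα : IsTimescaleSeparated α) {ξ : ℕ → State d}
    (hx : ∀ n j, x (n + 1) j = x n j + α j n • (h j (x n) + ξ n j))
    (hξ : ∀ j, ∃ s, Tendsto (fun n => ∑ k ∈ Finset.range n, α j k • ξ k j) atTop (𝓝 s))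
    (hR : ∀ n, ‖x n‖ ≤ R) (hlamLip : ∀ i < ⊤, ∃ L, LipschitzWith L (lam i))
    (hlam : ∀ i < ⊤, ∀ z : State d,
      IsGlobAsympStable (limitField h lam i z) (lam i fun k => z k.1))
    {xstar : Block d ⊤} (hxstar : IsGlobAsympStable (limitField h lam ⊤ 0) xstar) (j : Fin N) :
    Tendsto (fun n => x n j) atTop (𝓝 (lamTo lam j xstar)) := by
  choose s hs using hξ
  -- Adding the future noise to the iterate removes the noise from the recursion.
  let tail (n : ℕ) : State d := fun j => s j - ∑ k ∈ Finset.range n, α j k • ξ k j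
  have htail : Tendsto tail atTop (𝓝 0) := tendsto_pi_nhds.2 fun j => by
    simpa only [sub_self, Pi.zero_apply] using (hs j).const_sub (s j)
  obtain ⟨T, hT⟩ := htail.norm.bddAbove_range
  have herr : Tendsto (fun n j => h j (x n) - h j (x n + tail n)) atTop (𝓝 0) :=
    tendsto_pi_nhds.2 fun j => by
      obtain ⟨L, hL⟩ := hh j
      refine tendsto_sub_zero_of_uniformContinuous hL.uniformContinuous ?_
      simpa only [sub_add_cancel_left, neg_zero] using htail.neg
  have hshift := tendsto_lamTo_of_tendsto_error (x := fun n => x n + tail n) hh hα (fun n j => by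
      simp only [Pi.add_apply, tail, Finset.sum_range_succ, hx n j, add_sub_cancel, smul_add]
      abel) herr (fun n => (norm_add_le _ _).trans (add_le_add (hR n) (hT ⟨n, rfl⟩)))
    hlamLip hlam hxstar j
  simpa only [Pi.add_apply, add_sub_cancel_right, Pi.zero_apply, sub_zero] using
    hshift.sub (tendsto_pi_nhds.1 htail j)

end Levels

section History

variable {N : ℕ} {d : Fin N → ℕ} {Ω : Type*} {x M : ∀ j : Fin N, ℕ → Ω → Block d j}

theorem history_mono : Monotone (history x M) := fun _ _ hmn =>
  iSup_mono fun _ => sup_le_sup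
    (iSup_mono fun _ => iSup_le fun hi => le_iSup_of_le (hi.trans hmn) le_rfl)
    (iSup_mono fun _ => iSup_le fun hi => le_iSup_of_le ⟨hi.1, hi.2.trans hmn⟩ le_rfl)

theorem measurable_iterate_history (j : Fin N) (n : ℕ) : Measurable[history x M n] (x j n) := by
  rw [measurable_iff_comap_le]
  exact le_iSup_of_le j (le_sup_of_le_left (le_iSup₂_of_le n le_rfl le_rfl))

theorem measurable_noise_history (j : Fin N) (n : ℕ) :
    Measurable[history x M (n + 1)] (M j (n + 1)) := by
  rw [measurable_iff_comap_le]
  exact le_iSup_of_le j (le_sup_of_le_right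
    (le_iSup₂_of_le (n + 1) ⟨Nat.le_add_left 1 n, le_rfl⟩ le_rfl))

theorem measurable_sum_norm_sq_history (n : ℕ) :
    Measurable[history x M n] fun ω => ∑ j, ‖x j n ω‖ ^ 2 :=
  letI := history x M n
  Finset.measurable_sum _ fun j _ => (measurable_iterate_history j n).norm.pow_const 2

variable [mΩ : MeasurableSpace Ω]

theorem history_le (hx : ∀ j n, Measurable (x j n)) (hM : ∀ j n, Measurable (M j (n + 1)))
    (n : ℕ) : history x M n ≤ mΩ := by
  refine iSup_le fun j => sup_le (iSup₂_le fun i _ => (hx j i).comap_le) (iSup₂_le fun i hi => ?_)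
  obtain ⟨k, rfl⟩ := Nat.exists_eq_add_of_le' hi.1
  exact (hM j k).comap_le

theorem measurable_iterate {h : ∀ j : Fin N, State d → Block d j} {α : Fin N → ℕ → ℝ}
    (hx0 : ∀ j, Measurable (x j 0)) (hM : ∀ j n, Measurable (M j (n + 1)))
    (hrec : ∀ j n ω, x j (n + 1) ω =
      x j n ω + α j n • (h j (fun k => x k n ω) + M j (n + 1) ω))
    (hh : ∀ j, Measurable (h j)) (j : Fin N) (n : ℕ) : Measurable (x j n) := by
  induction n generalizing j with
  | zero => exact hx0 j
  | succ n ih =>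
    have hdrift : Measurable fun ω => h j fun k => x k n ω :=
      (hh j).comp (measurable_pi_lambda _ fun k => ih k)
    rw [funext (hrec j n)]
    exact (ih j).add ((hdrift.add (hM j n)).const_smul (α j n))

theorem ae_bddAbove_imp_exists_tendsto_sum_noise {P : Measure Ω} [IsFiniteMeasure P]
    (hx : ∀ j n, Measurable (x j n)) (hM : ∀ j n, Measurable (M j (n + 1))) {j : Fin N}
    (hint : ∀ n, Integrable (M j (n + 1)) P)
    (hmart : ∀ n, P[M j (n + 1) | history x M n] =ᵐ[P] 0) {K : ℝ} (hK : 0 ≤ K)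
    (hvar : ∀ n, ∀ᵐ ω ∂P, condLExp (history x M n) P (fun ω' => ‖M j (n + 1) ω'‖ₑ ^ 2) ω ≤
      ENNReal.ofReal (K * (1 + ∑ k, ‖x k n ω‖ ^ 2)))
    {a : ℕ → ℝ} (ha : Summable fun n => a n ^ 2) :
    ∀ᵐ ω ∂P, BddAbove (range fun n => ∑ k, ‖x k n ω‖) →
      ∃ s, Tendsto (fun n => ∑ k ∈ Finset.range n, a k • M j (k + 1) ω) atTop (𝓝 s) := by
  let ℱ : Filtration ℕ mΩ := ⟨history x M, history_mono, history_le hx hM⟩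
  have hbound (n) : Measurable[ℱ n] fun ω => K * (1 + ∑ k, ‖x k n ω‖ ^ 2) :=
    .const_mul (.const_add (measurable_sum_norm_sq_history n) 1) K
  filter_upwards [ae_bddAbove_imp_exists_tendsto_sum_smul (ℱ := ℱ) (M := fun n => M j (n + 1)) ha
    (fun n => (measurable_noise_history j n).stronglyMeasurable) hint hmart hbound hvar]
    with ω hω ⟨R, hR⟩
  refine hω ⟨K * (1 + R ^ 2), forall_mem_range.2 fun n => ?_⟩
  have hsq : ∑ k, ‖x k n ω‖ ^ 2 ≤ (∑ k, ‖x k n ω‖) ^ 2 :=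
    Finset.sum_sq_le_sq_sum_of_nonneg fun _ _ => norm_nonneg _
  have hle : ∑ k, ‖x k n ω‖ ≤ R := hR (mem_range_self n)
  gcongr
  exact hsq.trans (by gcongr)

end History

theorem theorem2_general {N : ℕ} [NeZero N] (d : Fin N → ℕ)
    {Ω : Type*} [mΩ : MeasurableSpace Ω] (P : Measure Ω) [IsFiniteMeasure P]
    (h : ∀ j : Fin N, State d → Block d j)
    (α : Fin N → ℕ → ℝ)
    (x M : ∀ j : Fin N, ℕ → Ω → Block d j)
    (hx0 : ∀ j, Measurable (x j 0))
    (hM : ∀ j n, Measurable (M j (n + 1)))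
    (hrec : ∀ j n ω, x j (n + 1) ω =
      x j n ω + α j n • (h j (fun k => x k n ω) + M j (n + 1) ω))
    (hLip : ∀ j, ∃ L, LipschitzWith L (h j))
    (hint : ∀ j n, Integrable (M j (n + 1)) P)
    (hmart : ∀ j n, P[M j (n + 1) | history x M n] =ᵐ[P] 0)
    (hvar : ∀ i, ∃ K : ℝ, 0 < K ∧ ∀ n, ∀ᵐ ω ∂P,
      condLExp (history x M n) P (fun ω' => ‖M i (n + 1) ω'‖ₑ ^ 2) ω ≤
        ENNReal.ofReal (K * (1 + ∑ j, ‖x j n ω‖ ^ 2)))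
    (hαpos : ∀ j n, 0 < α j n)
    (hαsum : ∀ j, Tendsto (fun n => ∑ k ∈ Finset.range n, α j k) atTop atTop)
    (hαsq : Summable (fun n => ∑ j, α j n ^ 2))
    (hαratio : ∀ i j : Fin N, i.val + 1 = j.val →
      Tendsto (fun n => α j n / α i n) atTop (𝓝 0))
    (lam : ∀ i : Fin N, SlowerState d i → Block d i)
    (hlamLip : ∀ i, i < ⊤ → ∃ L, LipschitzWith L (lam i))
    (hlam : ∀ i, i < ⊤ → ∀ z : State d,
      IsGlobAsympStable (limitField h lam i z) (lam i (fun k => z k.1)))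
    (xstar : Block d ⊤)
    (hxstar : IsGlobAsympStable (limitField h lam ⊤ 0) xstar) :
    ∀ᵐ ω ∂P, BddAbove (range fun n => ∑ j, ‖x j n ω‖) →
      ∀ j, Tendsto (fun n => x j n ω) atTop (𝓝 (lamTo lam j xstar)) := by
  have hsq (j) : Summable fun n => α j n ^ 2 := hαsq.of_nonneg_of_le (fun _ => sq_nonneg _)
    fun n => Finset.single_le_sum (f := fun j => α j n ^ 2) (fun _ _ => sq_nonneg _)
      (Finset.mem_univ j)
  have hα : IsTimescaleSeparated α := isTimescaleSeparated_of_summable hαpos hαsum hsq hαratio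
  have hx := measurable_iterate hx0 hM hrec fun j => (hLip j).elim fun _ hL =>
    hL.continuous.measurable
  have hnoise : ∀ᵐ ω ∂P, ∀ j, BddAbove (range fun n => ∑ k, ‖x k n ω‖) →
      ∃ s, Tendsto (fun n => ∑ k ∈ Finset.range n, α j k • M j (k + 1) ω) atTop (𝓝 s) :=
    ae_all_iff.2 fun j => (hvar j).elim fun _ ⟨hK, hKvar⟩ =>
      ae_bddAbove_imp_exists_tendsto_sum_noise hx hM (hint j) (hmart j) hK.le hKvar (hsq j)
  filter_upwards [hnoise] with ω hω ⟨R, hR⟩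
  have hnorm (n) : ‖fun j => x j n ω‖ ≤ R :=
    (pi_norm_le_iff_of_nonempty _).2 fun j =>
      (Finset.single_le_sum (f := fun j => ‖x j n ω‖) (fun _ _ => norm_nonneg _)
        (Finset.mem_univ j)).trans (hR (mem_range_self n))
  exact tendsto_lamTo_of_tendsto_noise (x := fun n j => x j n ω)
    (ξ := fun n j => M j (n + 1) ω) hLip hα (fun n j => hrec j n ω) (fun j => hω j ⟨R, hR⟩) hnorm
    hlamLip hlam hxstar

theorem theorem2 {N : ℕ} [NeZero N] (d : Fin N → ℕ)
    {Ω : Type*} [mΩ : MeasurableSpace Ω] (P : Measure Ω) [IsProbabilityMeasure P]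
    (h : ∀ j : Fin N, State d → Block d j)
    (α : Fin N → ℕ → ℝ)
    (x M : ∀ j : Fin N, ℕ → Ω → Block d j)
    -- the `N` recursions
    (hx0 : ∀ j, Measurable (x j 0))
    (hM : ∀ j n, Measurable (M j (n + 1)))
    (hrec : ∀ j n ω, x j (n + 1) ω =
      x j n ω + α j n • (h j (fun k => x k n ω) + M j (n + 1) ω))
    -- Lipschitz continuity
    (hLip : ∀ j, ∃ L, LipschitzWith L (h j))
    -- martingale difference noise with conditional second moment bound
    (hint : ∀ j n, Integrable (M j (n + 1)) P)
    (hmart : ∀ j n, P[M j (n + 1) | history x M n] =ᵐ[P] 0)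
    (hvar : ∀ i, ∃ K : ℝ, 0 < K ∧ ∀ n, ∀ᵐ ω ∂P,
      condLExp (history x M n) P (fun ω' => ‖M i (n + 1) ω'‖ₑ ^ 2) ω ≤
        ENNReal.ofReal (K * (1 + ∑ j, ‖x j n ω‖ ^ 2)))
    -- step sizes
    (hαpos : ∀ j n, 0 < α j n)
    (hαsum : ∀ j, Tendsto (fun n => ∑ k ∈ Finset.range n, α j k) atTop atTop)
    (hαsq : Summable (fun n => ∑ j, α j n ^ 2))
    (hαratio : ∀ i j : Fin N, i.val + 1 = j.val →
      Tendsto (fun n => α j n / α i n) atTop (𝓝 0))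
    -- stability of the iterates
    (hstab : ∀ᵐ ω ∂P, BddAbove (Set.range fun n => ∑ j, ‖x j n ω‖))
    -- globally asymptotically stable equilibria of the limiting equations
    (lam : ∀ i : Fin N, SlowerState d i → Block d i)
    (hlamLip : ∀ i, i < ⊤ → ∃ L, LipschitzWith L (lam i))
    (hlam : ∀ i, i < ⊤ → ∀ z : State d,
      IsGlobAsympStable (limitField h lam i z) (lam i (fun k => z k.1)))
    (xstar : Block d ⊤)
    (hxstar : IsGlobAsympStable (limitField h lam ⊤ 0) xstar) :
    ∀ᵐ ω ∂P, (∀ j, j < ⊤ → Tendsto (fun n => x j n ω) atTop (𝓝 (lamTo lam j xstar))) ∧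
      Tendsto (fun n => x ⊤ n ω) atTop (𝓝 xstar) := by
  filter_upwards [hstab, theorem2_general d P h α x M hx0 hM hrec hLip hint hmart hvar hαpos hαsum
    hαsq hαratio lam hlamLip hlam xstar hxstar] with ω hbdd hconv
  exact ⟨fun j _ => hconv hbdd j, by simpa only [lamTo_top] using hconv hbdd ⊤⟩
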